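/- **Setting.** A switch has finitely many ingress ports and finitely many egress ports; port $\ell$ has capacity $b_\ell>0$, and $\mathcal L$ is the set of all ports. There are $n$ coflows $\mathcal C=\{1,\dots,n\}$, all present at time $0$. Coflow $k$ has weight $w_k\ge 0$ and is a finite set $F_k$ of flows. Flow $j\in F_k$ has a source (ingress port), a destination (egress port) and a random volume $V^{k,j}\ge 0$; the volumes are independent with finite first and second moments. Let $F_{k,\ell}\subseteq F_k$ be the flows of coflow $k$ that use port $\ell$, and let $$P_{\ell,k}=\frac1{b_\ell}\sum_{j\in F_{k,\ell}}V^{k,j},\qquad \mu_{\ell,k}=\mathbb E[P_{\ell,k}].$$ **Policies.** A rate-allocation policy gives nonnegative rates to the unfinished flows such that the total rate on every port $\ell$ is at most $b_\ell$, and transmits some flow as long as a flow is unfinished. Rates are constant between decision epochs (time $0$ and the flow completion times), and at an epoch they depend only on the sets of flows finished and in transmission (volumes are revealed upon completion only, so a flow must be transmitted in order to finish, also when its volume is $0$). A coflow completes when its last flow finishes; $C_k(r)$ is the completion time of coflow $k$ under policy $r$. A policy is *order-based* if there is a fixed partial order on the flows, in which any two flows with the same source or the same destination are comparable, such that an unfinished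 flow has a positive rate exactly when no unfinished flow with the same source or the same destination precedes it. In particular, no port transmits two flows at once, and the order in which the flows of a port finish does not depend on the volumes. Let $\mathcal R$ be the set of order-based policies and $$C^{OPT}=\inf_{r\in\mathcal R}\ \sum_{k\in\mathcal C}w_k\,\mathbb E[C_k(r)].$$ **Sincronia order.** Start with $A=\mathcal C$. For $t=n,\dots,1$: choose a bottleneck port $b\in\arg\max_\ell\sum_{k\in A}\mu_{\ell,k}$ and a coflow $k^*\in\arg\min_{k\in A}w_k/\mu_{b,k}$ (a quotient by $0$ counts as $+\infty$, ties are broken arbitrarily); set $\pi(t)=k^*$; replace $w_k$ by $w_k-w_{k^*}\mu_{b,k}/\mu_{b,k^*}$ for all $k\in A$ (no change if $\mu_{b,k^*}=0$); remove $k^*$ from $A$. The output is the priority order $\pi$ ($\pi(1)$ first). **Greedy rate allocation.** List the flows so that all flows of $\pi(t)$ precede those of $\pi(t')$ for $t<t'$ (the order inside a coflow is arbitrary). At each decision epoch, go through the unfinished flows in this order and give each one the largest rate that the remaining capacities of its two ports allow. (If all ports have the same capacity, each flow gets either the full rate of its ports or rate $0$.) Let $C_k$ be the completion time of coflow $k$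 under this policy. **Theorem.** Let $\pi$ be any order computed by Sincronia from the expected processing times $\mu_{\ell,k}$ and the weights $w_k$, and let $$\alpha=\max_{t=1,\dots,n}\frac{\mathbb E\big[\max_{\ell}\sum_{\tau=1}^tP_{\ell,\pi(\tau)}\big]}{\max_\ell\sum_{\tau=1}^t\mu_{\ell,\pi(\tau)}}$$ (with $0/0=0$). Then all completion times $C_k$ and $C_k(r)$, $r\in\mathcal R$, are integrable, and $$\sum_{k\in\mathcal C}w_k\,\mathbb E[C_k]\ \le\ 4\,\alpha\;C^{OPT}.$$ -/

import Mathlib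

open MeasureTheory ProbabilityTheory

noncomputable section

/-- The deterministic data of a coflow scheduling problem on the big switch: ingress ports `I`,
egress ports `O`, flows `F`, coflows `Fin n`. Coflow `k` is the set of flows `f` with
`coflow f = k`; every port has a capacity and every coflow a weight. -/
structure CoflowInstance (n : ℕ) (I O F : Type*) where
  coflow : F → Fin n
  src : F → I
  dst : F → O
  cap : I ⊕ O → ℝ
  cap_pos : ∀ ℓ, 0 < cap ℓ
  weight : Fin n → ℝ
  weight_nonneg : ∀ k, 0 ≤ weight k

/-- A rate allocation rule. `ρ D G f` is the rate given to flow `f` from a decision epoch (time `0`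
or a flow completion) until the next one, where `D` is the set of flows finished at that epoch and
`G` is the set of unfinished flows in transmission just before it. Such a rule is nonanticipative
and has constant rates between decision epochs by construction. -/
abbrev RateRule (F : Type*) := Finset F → Finset F → F → ℝ

/-- State of the system at a decision epoch: the current time, the finished flows, the unfinished
flows that were in transmission just before, the remaining volumes, and the completion times of the
finished flows. -/
structure SimState (F : Type*) where
  time : ℝ
  done : Finset F
  ongoing : Finset F
  rem : F → ℝ
  comp : F → ℝ

namespace RateRule

variable {F : Type*} [Fintype F] [DecidableEq F]

/-- The unfinished flows that are transmitted from the current epoch on. -/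
def served (ρ : RateRule F) (s : SimState F) : Finset F :=
  Finset.univ.filter fun f => f ∉ s.done ∧ 0 < ρ s.done s.ongoing f

/-- Time until the next flow completion. -/
def delay (ρ : RateRule F) (s : SimState F) : ℝ :=
  ⨅ f : {f // f ∈ ρ.served s}, s.rem f / ρ s.done s.ongoing f

/-- The flows that finish at the next epoch. A flow has to be transmitted in order to finish, also
when its volume is zero: volumes are revealed upon completion only. -/
def finishing (ρ : RateRule F) (s : SimState F) : Finset F :=
  (ρ.served s).filter fun f => s.rem f / ρ s.done s.ongoing f ≤ ρ.delay s

/-- The state at the next decision epoch. -/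
def step (ρ : RateRule F) (s : SimState F) : SimState F where
  time := s.time + ρ.delay s
  done := s.done ∪ ρ.finishing s
  ongoing := ρ.served s \ ρ.finishing s
  rem := fun f => if f ∈ ρ.served s then s.rem f - ρ s.done s.ongoing f * ρ.delay s else s.rem f
  comp := fun f => if f ∈ ρ.finishing s then s.time + ρ.delay s else s.comp f

/-- Completion time of flow `f` under `ρ` for the volumes `v`. If at every epoch some unfinished
flow is transmitted, at least one flow finishes per step, so that all are finished after
`Fintype.card F` steps. -/
def flowCompletion (ρ : RateRule F) (v : F → ℝ) (f : F) : ℝ :=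
  (ρ.step^[Fintype.card F]
    { time := 0, done := ∅, ongoing := ∅, rem := v, comp := fun _ => 0 }).comp f

end RateRule

namespace CoflowInstance

variable {n : ℕ} {I O F Ω : Type*}

/-- The two ports used by a flow. -/
def ports [DecidableEq I] [DecidableEq O] (X : CoflowInstance n I O F) (f : F) : Finset (I ⊕ O) :=
  {Sum.inl (X.src f), Sum.inr (X.dst f)}

/-- Completion time of coflow `k`: the time at which its last flow finishes. -/
def coflowCompletion [Fintype F] [DecidableEq F] (X : CoflowInstance n I O F) (ρ : RateRule F)
    (v : F → ℝ) (k : Fin n) : ℝ :=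
  ⨆ f : {f : F // X.coflow f = k}, ρ.flowCompletion v f

/-- Admissible rate allocation: rates are nonnegative, the capacity of every port is respected, and
the system never idles while a flow is unfinished. -/
structure IsAdmissible [Fintype F] [DecidableEq I] [DecidableEq O] [DecidableEq F]
    (X : CoflowInstance n I O F) (ρ : RateRule F) : Prop where
  nonneg : ∀ D G f, 0 ≤ ρ D G f
  capacity : ∀ D G ℓ,
    ∑ f ∈ Finset.univ.filter (fun f => f ∉ D ∧ ℓ ∈ X.ports f), ρ D G f ≤ X.cap ℓ
  no_idling : ∀ D G, D ≠ Finset.univ → ∃ f, f ∉ D ∧ 0 < ρ D G f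

/-- Two flows with the same source or the same destination. -/
def SharePort (X : CoflowInstance n I O F) (f g : F) : Prop :=
  X.src f = X.src g ∨ X.dst f = X.dst g

/-- Order-based rule: there is a fixed partial order on the flows, in which any two flows with a
common port are comparable, such that a flow is transmitted exactly when no unfinished flow on one
of its two ports precedes it. So a port never transmits two flows at the same time, and the order in
which the flows of a port finish does not depend on the volumes. -/
def IsOrderBased (X : CoflowInstance n I O F) (ρ : RateRule F) : Prop :=
  ∃ lt : F → F → Prop, IsStrictOrder F lt ∧
    (∀ f g, f ≠ g → X.SharePort f g → lt f g ∨ lt g f) ∧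
    ∀ D G f, f ∉ D → (0 < ρ D G f ↔ ∀ g, g ∉ D → X.SharePort g f → ¬ lt g f)

/-- Expected weighted completion time of a rate allocation rule, for random volumes `V`. -/
def expectedCost [Fintype F] [DecidableEq F] [MeasurableSpace Ω] (X : CoflowInstance n I O F)
    (P : Measure Ω) (V : F → Ω → ℝ) (ρ : RateRule F) : ℝ :=
  ∑ k, X.weight k * ∫ ω, X.coflowCompletion ρ (fun f => V f ω) k ∂P

/-- The optimal expected weighted completion time over the admissible order-based rules. -/
def optimum [Fintype F] [DecidableEq I] [DecidableEq O] [DecidableEq F] [MeasurableSpace Ω]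
    (X : CoflowInstance n I O F) (P : Measure Ω) (V : F → Ω → ℝ) : ℝ :=
  ⨅ ρ : {ρ : RateRule F // X.IsAdmissible ρ ∧ X.IsOrderBased ρ}, X.expectedCost P V ρ.1

/-- Processing time of coflow `k` on port `ℓ` in isolation, for the volumes `v`. -/
def procTime [Fintype F] [DecidableEq I] [DecidableEq O] (X : CoflowInstance n I O F)
    (v : F → ℝ) (ℓ : I ⊕ O) (k : Fin n) : ℝ :=
  (∑ f ∈ Finset.univ.filter (fun f => X.coflow f = k ∧ ℓ ∈ X.ports f), v f) / X.cap ℓ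

/-- Expected processing time of coflow `k` on port `ℓ`. -/
def meanProcTime [Fintype F] [DecidableEq I] [DecidableEq O] [MeasurableSpace Ω]
    (X : CoflowInstance n I O F) (P : Measure Ω) (V : F → Ω → ℝ) (ℓ : I ⊕ O) (k : Fin n) : ℝ :=
  ∫ ω, X.procTime (fun f => V f ω) ℓ k ∂P

/-- The ratio `α` of the priority order `π` (`π 0` has the highest priority): the largest value,
over the prefixes of the order, of the expected bottleneck load divided by the bottleneck of the
expected loads. A prefix without any expected load contributes `0 / 0 = 0`. -/
def alpha [Fintype F] [DecidableEq I] [DecidableEq O] [MeasurableSpace Ω]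
    (X : CoflowInstance n I O F) (P : Measure Ω) (V : F → Ω → ℝ) (π : Equiv.Perm (Fin n)) : ℝ :=
  ⨆ t : Fin n,
    (∫ ω, ⨆ ℓ, ∑ τ ∈ Finset.Iic t, X.procTime (fun f => V f ω) ℓ (π τ) ∂P) /
      (⨆ ℓ, ∑ τ ∈ Finset.Iic t, X.meanProcTime P V ℓ (π τ))

/-- A list of all flows by decreasing priority: flows of a coflow that comes earlier in `π` precede
those of a later one, and flows of the same coflow are listed in any order. -/
def IsPriorityList (X : CoflowInstance n I O F) (π : Equiv.Perm (Fin n)) (l : List F) : Prop :=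
  l.Nodup ∧ (∀ f, f ∈ l) ∧
    l.Pairwise fun f g => π.symm (X.coflow f) ≤ π.symm (X.coflow g)

/-- Rates obtained by going through a list of flows, with `c` the residual capacities, and giving to
each flow all the rate that its two ports still allow. -/
def greedyAlloc [DecidableEq I] [DecidableEq O] [DecidableEq F] (X : CoflowInstance n I O F) :
    List F → (I ⊕ O → ℝ) → F → ℝ
  | [], _, _ => 0
  | f :: l, c, g =>
    let x := min (c (Sum.inl (X.src f))) (c (Sum.inr (X.dst f)))
    if g = f then x else greedyAlloc X l (fun ℓ => if ℓ ∈ X.ports f then c ℓ - x else c ℓ) g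

/-- Greedy (preemptive) rate allocation for a priority list of flows: at every decision epoch the
unfinished flows are gone through by decreasing priority, and each one gets all the rate that is
left on its two ports. With equal port capacities a flow thus gets the full rate of its two ports
if both are free, and no rate otherwise. -/
def greedy [DecidableEq I] [DecidableEq O] [DecidableEq F] (X : CoflowInstance n I O F)
    (l : List F) : RateRule F :=
  fun D _ => X.greedyAlloc (l.filter fun f => f ∉ D) X.cap

end CoflowInstance

/-- The quotient `w / m` of a weight and a processing time `m ≥ 0`, infinite when `m = 0`. -/
def weightRatio (w m : ℝ) : WithTop ℝ :=
  if m = 0 then ⊤ else ((w / m : ℝ) : WithTop ℝ)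

/-- `SincroniaRun μ A w l`: the Sincronia priority loop, run on the set `A` of unscheduled coflows
with current weights `w` and processing times `μ ℓ k`, can output the list `l` (highest priority
first). The loop takes a bottleneck port `b` of `A`, gives the lowest priority in `A` to a coflow `k`
with the least `w k / μ b k`, updates the weights and goes on with `A` without `k`. Ties are broken
in any way. (When `μ b k = 0`, no coflow in `A` has any load and the weights do not change.) -/
inductive SincroniaRun {n : ℕ} {L : Type*} (μ : L → Fin n → ℝ) :
    Finset (Fin n) → (Fin n → ℝ) → List (Fin n) → Prop
  | nil (w : Fin n → ℝ) : SincroniaRun μ ∅ w []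
  | step (A : Finset (Fin n)) (w : Fin n → ℝ) (l : List (Fin n)) (b : L) (k : Fin n)
      (hb : ∀ ℓ, ∑ j ∈ A, μ ℓ j ≤ ∑ j ∈ A, μ b j)
      (hk : k ∈ A)
      (hmin : ∀ j ∈ A, weightRatio (w k) (μ b k) ≤ weightRatio (w j) (μ b j))
      (hrest : SincroniaRun μ (A.erase k)
        (fun j => if j ∈ A then w j - w k * μ b j / μ b k else w j) l) :
      SincroniaRun μ A w (l ++ [k])

end

/-! Both sides are compared with the bottlenecks `M k = ⨆ ℓ, ∑ μ ℓ j`, where `j` runs over the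
coflows up to `k` in the Sincronia order.

Upper bound. While a flow is unfinished, the greedy rule saturates one of its two ports with flows
of no lower priority (`exists_port_saturated`). The elapsed time is thus at most the sum of the
prefix loads of these two ports, hence at most twice the random bottleneck load of the prefix.
Taking expectations and using the definition of `alpha`, greedy costs at most `2 α ∑ w k * M k`.

Lower bound. Under an order-based rule, the set of flows that precede `f` on a port does not depend
on the volumes, so the pathwise bound "predecessors first" can be integrated. Weighting it by the
mean processing times and summing gives the parallel inequalities `(∑ k ∈ A, μ ℓ k) ^ 2 ≤ 2 * ∑ k ∈
A, μ ℓ k * E[C k]` for every port and every set of coflows (`sq_sum_meanProcTime_le`). Sincronia is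
a primal-dual algorithm for the linear program with these constraints: each iteration removes a
multiple of `μ b` from the weights, and one parallel inequality pays for it (`SincroniaRun.sum_le`).
Hence `∑ w k * M k` is at most twice the cost of any order-based rule, and the two factors 2 give `4
α`. -/

/-! ### Dynamics of the simulation under a rate rule. -/

namespace RateRule

variable {F : Type*} [Fintype F] [DecidableEq F]

/-- The initial state for the volumes `v`. -/
def start (v : F → ℝ) : SimState F :=
  { time := 0, done := ∅, ongoing := ∅, rem := v, comp := fun _ => 0 }

/-- The state after `i` flow completion epochs. -/
noncomputable def stateAt (ρ : RateRule F) (v : F → ℝ) (i : ℕ) : SimState F :=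
  ρ.step^[i] (start v)

theorem stateAt_zero (ρ : RateRule F) (v : F → ℝ) : ρ.stateAt v 0 = start v := rfl

theorem stateAt_succ (ρ : RateRule F) (v : F → ℝ) (i : ℕ) :
    ρ.stateAt v (i + 1) = ρ.step (ρ.stateAt v i) :=
  Function.iterate_succ_apply' _ _ _

theorem flowCompletion_eq (ρ : RateRule F) (v : F → ℝ) (f : F) :
    ρ.flowCompletion v f = (ρ.stateAt v (Fintype.card F)).comp f := rfl

theorem mem_served {ρ : RateRule F} {s : SimState F} {f : F} :
    f ∈ ρ.served s ↔ f ∉ s.done ∧ 0 < ρ s.done s.ongoing f := by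
  simp [served]

theorem mem_finishing {ρ : RateRule F} {s : SimState F} {f : F} :
    f ∈ ρ.finishing s ↔ f ∈ ρ.served s ∧ s.rem f / ρ s.done s.ongoing f ≤ ρ.delay s := by
  simp [finishing]

theorem delay_le (ρ : RateRule F) (s : SimState F) {f : F} (hf : f ∈ ρ.served s) :
    ρ.delay s ≤ s.rem f / ρ s.done s.ongoing f :=
  ciInf_le (f := fun g : {g // g ∈ ρ.served s} => s.rem g / ρ s.done s.ongoing g)
    (Set.finite_range _).bddBelow ⟨f, hf⟩

theorem delay_nonneg (ρ : RateRule F) (s : SimState F) (h : ∀ f, 0 ≤ s.rem f) :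
    0 ≤ ρ.delay s :=
  Real.iInf_nonneg fun f => div_nonneg (h f) (mem_served.1 f.2).2.le

theorem delay_mul_le (ρ : RateRule F) (s : SimState F) {f : F} (hf : f ∈ ρ.served s) :
    ρ s.done s.ongoing f * ρ.delay s ≤ s.rem f := by
  have := ρ.delay_le s hf
  rwa [le_div_iff₀ (mem_served.1 hf).2, mul_comm] at this

theorem delay_mul_eq (ρ : RateRule F) (s : SimState F) {f : F} (hf : f ∈ ρ.finishing s) :
    ρ s.done s.ongoing f * ρ.delay s = s.rem f := by
  obtain ⟨h1, h2⟩ := mem_finishing.1 hf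
  rw [div_le_iff₀ (mem_served.1 h1).2, mul_comm] at h2
  exact le_antisymm (ρ.delay_mul_le s h1) h2

/-- A real infimum over an empty type is `0`, so time stands still in a step without transmission.
-/
theorem delay_eq_zero (ρ : RateRule F) (s : SimState F) (h : ρ.served s = ∅) :
    ρ.delay s = 0 := by
  have : IsEmpty {f // f ∈ ρ.served s} := ⟨fun f => by simpa [h] using f.2⟩
  exact Real.iInf_of_isEmpty _

theorem finishing_nonempty (ρ : RateRule F) (s : SimState F) (h : (ρ.served s).Nonempty) :
    (ρ.finishing s).Nonempty := by
  have : Nonempty {f // f ∈ ρ.served s} := h.to_subtype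
  obtain ⟨f, hf⟩ := exists_eq_ciInf_of_finite
    (f := fun g : {g // g ∈ ρ.served s} => s.rem g / ρ s.done s.ongoing g)
  exact ⟨f, mem_finishing.2 ⟨f.2, hf.le⟩⟩

/-- The volume of a flow that is transmitted in one step. -/
theorem rem_step (ρ : RateRule F) (hρ : ∀ D G f, 0 ≤ ρ D G f) (s : SimState F) (f : F) :
    (ρ.step s).rem f =
      s.rem f - if f ∈ s.done then 0 else ρ s.done s.ongoing f * ρ.delay s := by
  simp only [step, mem_served]
  by_cases h : f ∈ s.done
  · simp [h]
  -- An unfinished flow that is not served has rate exactly `0`, so the product formula covers it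
  -- too.
  · rcases (hρ s.done s.ongoing f).eq_or_lt with h' | h'
    · simp [h, ← h']
    · simp [h, h']

/-- The facts about volumes and times that hold at every decision epoch. -/
structure Regular (v : F → ℝ) (s : SimState F) : Prop where
  rem_nonneg : ∀ f, 0 ≤ s.rem f
  rem_le : ∀ f, s.rem f ≤ v f
  rem_done : ∀ f ∈ s.done, s.rem f = 0
  time_nonneg : 0 ≤ s.time
  comp_nonneg : ∀ f, 0 ≤ s.comp f
  comp_le_time : ∀ f, s.comp f ≤ s.time

theorem Regular.step {ρ : RateRule F} (hρ : ∀ D G f, 0 ≤ ρ D G f) {v : F → ℝ} {s : SimState F}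
    (h : Regular v s) : Regular v (ρ.step s) := by
  have hd := ρ.delay_nonneg s h.rem_nonneg
  refine ⟨fun f => ?_, fun f => ?_, fun f hf => ?_, ?_, fun f => ?_, fun f => ?_⟩
  · simp only [RateRule.step]
    split_ifs with h1
    · linarith [ρ.delay_mul_le s h1]
    · exact h.rem_nonneg f
  · simp only [RateRule.step]
    split_ifs with h1
    · nlinarith [h.rem_le f, mul_nonneg (hρ s.done s.ongoing f) hd]
    · exact h.rem_le f
  · rcases Finset.mem_union.1 (show f ∈ s.done ∪ ρ.finishing s from hf) with h1 | h1
    · simp [rem_step ρ hρ, h1, h.rem_done f h1]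
    · have h2 := (mem_finishing.1 h1).1
      simp [rem_step ρ hρ, (mem_served.1 h2).1, ρ.delay_mul_eq s h1]
  · exact add_nonneg h.time_nonneg hd
  · simp only [RateRule.step]
    split_ifs
    · exact add_nonneg h.time_nonneg hd
    · exact h.comp_nonneg f
  · simp only [RateRule.step]
    split_ifs
    · exact le_rfl
    · linarith [h.comp_le_time f]

theorem regular_stateAt {ρ : RateRule F} (hρ : ∀ D G f, 0 ≤ ρ D G f) {v : F → ℝ}
    (hv : ∀ f, 0 ≤ v f) (i : ℕ) : Regular v (ρ.stateAt v i) := by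
  induction i with
  | zero => exact ⟨hv, fun _ => le_rfl, by simp [stateAt_zero, start], le_rfl, fun _ => le_rfl,
      fun _ => le_rfl⟩
  | succ i ih => rw [stateAt_succ]; exact ih.step hρ

theorem flowCompletion_nonneg {ρ : RateRule F} (hρ : ∀ D G f, 0 ≤ ρ D G f) {v : F → ℝ}
    (hv : ∀ f, 0 ≤ v f) (f : F) : 0 ≤ ρ.flowCompletion v f :=
  (regular_stateAt hρ hv _).comp_nonneg f

/-- A rule that never idles finishes all flows within `Fintype.card F` steps. -/
theorem done_stateAt {ρ : RateRule F} (hidle : ∀ D G, D ≠ Finset.univ → ∃ f, f ∉ D ∧ 0 < ρ D G f)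
    (v : F → ℝ) : (ρ.stateAt v (Fintype.card F)).done = Finset.univ := by
  have key : ∀ i, (ρ.stateAt v i).done = Finset.univ ∨ i ≤ (ρ.stateAt v i).done.card := by
    intro i
    induction i with
    | zero => simp
    | succ i ih =>
      rw [stateAt_succ]
      set s := ρ.stateAt v i
      have hdone : (ρ.step s).done = s.done ∪ ρ.finishing s := rfl
      by_cases hs : s.done = Finset.univ
      · left; simp [hdone, hs]
      · right
        obtain ⟨f, hf⟩ := hidle s.done s.ongoing hs
        obtain ⟨g, hg⟩ := ρ.finishing_nonempty s ⟨f, mem_served.2 hf⟩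
        have hg' := (mem_served.1 (mem_finishing.1 hg).1).1
        have : s.done ⊂ s.done ∪ ρ.finishing s :=
          Finset.ssubset_iff_of_subset Finset.subset_union_left |>.2
            ⟨g, Finset.mem_union_right _ hg, hg'⟩
        have := Finset.card_lt_card this
        rw [hdone]
        have := ih.resolve_left hs
        omega
  rcases key (Fintype.card F) with h | h
  · exact h
  · exact Finset.eq_univ_of_card _ (le_antisymm (Finset.card_le_univ _) h)

/-- A property of a flow and its completion time that is established in the step in which the flow
finishes holds for the final completion times. -/
theorem flowCompletion_of_finishing {ρ : RateRule F} {v : F → ℝ} {f : F}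
    (hidle : ∀ D G, D ≠ Finset.univ → ∃ f, f ∉ D ∧ 0 < ρ D G f) (p : ℝ → Prop)
    (h : ∀ i, f ∈ ρ.finishing (ρ.stateAt v i) → p (ρ.stateAt v (i + 1)).time) :
    p (ρ.flowCompletion v f) := by
  have key : ∀ i, f ∈ (ρ.stateAt v i).done → p ((ρ.stateAt v i).comp f) := by
    intro i
    induction i with
    | zero => simp [stateAt_zero, start]
    | succ i ih =>
      intro hf
      specialize h i
      rw [stateAt_succ] at hf h ⊢
      by_cases h1 : f ∈ ρ.finishing (ρ.stateAt v i)
      · simpa [step, h1] using h h1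
      · have h2 : f ∈ (ρ.stateAt v i).done := by
          rcases Finset.mem_union.1 hf with h2 | h2
          · exact h2
          · exact absurd h2 h1
        simpa [step, h1] using ih h2
  rw [flowCompletion_eq]
  exact key _ (by simp [done_stateAt hidle v])

omit [DecidableEq F] in
/-- The positive rates of a rule are bounded away from zero. -/
theorem exists_pos_le_rate (ρ : RateRule F) :
    ∃ c > 0, ∀ D G f, 0 < ρ D G f → c ≤ ρ D G f := by
  -- A rule takes finitely many values, since it sees only two finite sets; if none is positive, any
  -- constant works.
  by_cases h : Nonempty {p : Finset F × Finset F × F // 0 < ρ p.1 p.2.1 p.2.2}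
  · obtain ⟨p, hp⟩ := Finite.exists_min
      (fun p : {p : Finset F × Finset F × F // 0 < ρ p.1 p.2.1 p.2.2} => ρ p.1.1 p.1.2.1 p.1.2.2)
    exact ⟨_, p.2, fun D G f hf => hp ⟨(D, G, f), hf⟩⟩
  · exact ⟨1, one_pos, fun D G f hf => (h ⟨⟨(D, G, f), hf⟩⟩).elim⟩

/-- Whenever time passes, some flow is transmitted at rate at least `c`, so `c` times the elapsed
time is at most the transmitted volume. This is the bound that dominates completion times in the
integrability proof. -/
theorem mul_flowCompletion_le {ρ : RateRule F} (hρ : ∀ D G f, 0 ≤ ρ D G f) {c : ℝ} (hc : 0 < c)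
    (hcρ : ∀ D G f, 0 < ρ D G f → c ≤ ρ D G f) {v : F → ℝ} (hv : ∀ f, 0 ≤ v f) (f : F) :
    c * ρ.flowCompletion v f ≤ ∑ g, v g := by
  have key : ∀ i, c * (ρ.stateAt v i).time ≤ ∑ g, (v g - (ρ.stateAt v i).rem g) := by
    intro i
    induction i with
    | zero => simp [stateAt_zero, start]
    | succ i ih =>
      have hr := regular_stateAt hρ hv i
      rw [stateAt_succ]
      set s := ρ.stateAt v i
      have hd := ρ.delay_nonneg s hr.rem_nonneg
      have hterm : ∀ g, 0 ≤ if g ∈ s.done then 0 else ρ s.done s.ongoing g * ρ.delay s := by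
        intro g; split_ifs
        · exact le_rfl
        · exact mul_nonneg (hρ _ _ _) hd
      have hstep : c * ρ.delay s ≤
          ∑ g, if g ∈ s.done then 0 else ρ s.done s.ongoing g * ρ.delay s := by
        rcases (ρ.served s).eq_empty_or_nonempty with h0 | ⟨g, hg⟩
        · rw [ρ.delay_eq_zero s h0]; simp
        · have hg' := mem_served.1 hg
          refine le_trans ?_ (Finset.single_le_sum (fun g _ => hterm g) (Finset.mem_univ g))
          rw [if_neg hg'.1]
          exact mul_le_mul_of_nonneg_right (hcρ _ _ _ hg'.2) hd
      have hsum : ∑ g, (v g - (ρ.step s).rem g) = ∑ g, (v g - s.rem g) +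
          ∑ g, if g ∈ s.done then 0 else ρ s.done s.ongoing g * ρ.delay s := by
        rw [← Finset.sum_add_distrib]
        refine Finset.sum_congr rfl fun g _ => ?_
        rw [rem_step ρ hρ]; ring
      have ht : (ρ.step s).time = s.time + ρ.delay s := rfl
      rw [hsum, ht, mul_add]
      exact add_le_add ih hstep
  have hr := regular_stateAt hρ hv (Fintype.card F)
  calc c * ρ.flowCompletion v f ≤ c * (ρ.stateAt v (Fintype.card F)).time :=
        mul_le_mul_of_nonneg_left (hr.comp_le_time f) hc.le
    _ ≤ _ := key _
    _ ≤ _ := Finset.sum_le_sum fun g _ => by linarith [hr.rem_nonneg g]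

end RateRule

/-! ### Measurability of completion times in the volumes. -/

namespace RateRule

variable {F Ω : Type*} [Fintype F] [DecidableEq F] [MeasurableSpace Ω]

/-- A random state all of whose components are measurable. -/
structure MeasurableState (s : Ω → SimState F) : Prop where
  time : Measurable fun ω => (s ω).time
  rem : ∀ f, Measurable fun ω => (s ω).rem f
  comp : ∀ f, Measurable fun ω => (s ω).comp f
  sets : ∀ p : Finset F × Finset F, MeasurableSet {ω | ((s ω).done, (s ω).ongoing) = p}

omit [DecidableEq F] in
/-- A function of a measurable state may be checked to be measurable for fixed sets of finished and
ongoing flows. -/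
theorem MeasurableState.measurable_of_fixed {s : Ω → SimState F} (hs : MeasurableState s)
    {β : Type*} [MeasurableSpace β] (h : Finset F → Finset F → Ω → β)
    (hm : ∀ D G, Measurable (h D G)) :
    Measurable fun ω => h (s ω).done (s ω).ongoing ω := by
  intro B hB
  have : (fun ω => h (s ω).done (s ω).ongoing ω) ⁻¹' B =
      ⋃ p : Finset F × Finset F,
        {ω | ((s ω).done, (s ω).ongoing) = p} ∩ h p.1 p.2 ⁻¹' B := by
    ext ω
    simp [Prod.ext_iff]
  rw [this]
  exact MeasurableSet.iUnion fun p => (hs.sets p).inter (hm p.1 p.2 hB)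

theorem MeasurableState.step (ρ : RateRule F) {s : Ω → SimState F} (hs : MeasurableState s) :
    MeasurableState fun ω => ρ.step (s ω) := by
  classical
  -- `S`, `d` and `K` are the served flows, the delay and the finishing flows with the two sets `D`,
  -- `G` frozen; only the volumes still vary, and there are finitely many pairs `(D, G)`.
  let S : Finset F → Finset F → Finset F := fun D G =>
    Finset.univ.filter fun f => f ∉ D ∧ 0 < ρ D G f
  let d : Finset F → Finset F → Ω → ℝ := fun D G ω =>
    ⨅ f : {f // f ∈ S D G}, (s ω).rem f / ρ D G f
  have hd : ∀ D G, Measurable (d D G) := fun D G =>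
    Measurable.iInf fun f => (hs.rem f).div_const _
  let K : Finset F → Finset F → Ω → Finset F := fun D G ω =>
    (S D G).filter fun f => (s ω).rem f / ρ D G f ≤ d D G ω
  have hK : ∀ D G f, MeasurableSet {ω | f ∈ K D G ω} := by
    intro D G f
    by_cases hf : f ∈ S D G
    · simpa [K, hf] using measurableSet_le ((hs.rem f).div_const _) (hd D G)
    · simp [K, hf]
  have hdelay : Measurable fun ω => ρ.delay (s ω) := hs.measurable_of_fixed d hd
  refine ⟨hs.time.add hdelay, fun f => ?_, fun f => ?_, fun p => ?_⟩
  · refine hs.measurable_of_fixed (fun D G ω =>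
      if f ∈ S D G then (s ω).rem f - ρ D G f * d D G ω else (s ω).rem f) fun D G => ?_
    by_cases hf : f ∈ S D G
    · simp only [hf, if_true]
      exact (hs.rem f).sub ((hd D G).const_mul _)
    · simpa [hf] using hs.rem f
  · refine hs.measurable_of_fixed (fun D G ω =>
      if f ∈ K D G ω then (s ω).time + d D G ω else (s ω).comp f) fun D G => ?_
    exact Measurable.ite (hK D G f) (hs.time.add (hd D G)) (hs.comp f)
  · have hKm : ∀ D G E, MeasurableSet {ω | K D G ω = E} := by
      intro D G E
      have : {ω | K D G ω = E} = ⋂ f, {ω | f ∈ K D G ω ↔ f ∈ E} := by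
        ext ω; simp [Finset.ext_iff]
      rw [this]
      refine MeasurableSet.iInter fun f => ?_
      by_cases hf : f ∈ E
      · simpa [hf] using hK D G f
      · simp only [hf, iff_false]
        exact (hK D G f).compl
    -- The event is phrased as a `Prop`-valued measurable function so that `measurable_of_fixed`
    -- applies to it. For frozen sets it depends on `ω` only through `K`, which has finitely many
    -- values.
    have hset : ∀ q : Finset F × Finset F, Measurable fun ω =>
        ((q.1 ∪ K q.1 q.2 ω, S q.1 q.2 \ K q.1 q.2 ω) = p : Prop) := by
      intro q
      refine measurableSet_setOfPred.1 ?_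
      have : {ω | (q.1 ∪ K q.1 q.2 ω, S q.1 q.2 \ K q.1 q.2 ω) = p} =
          ⋃ E : Finset F, {ω | K q.1 q.2 ω = E} ∩ {_ω | (q.1 ∪ E, S q.1 q.2 \ E) = p} := by
        ext ω; simp
      rw [this]
      exact MeasurableSet.iUnion fun E => (hKm _ _ E).inter (MeasurableSet.const _)
    exact measurableSet_setOfPred.2 (hs.measurable_of_fixed
      (fun D G ω => ((D ∪ K D G ω, S D G \ K D G ω) = p : Prop)) fun D G => hset (D, G))

theorem measurable_flowCompletion (ρ : RateRule F) (f : F) :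
    Measurable fun v => ρ.flowCompletion v f := by
  have : ∀ i, MeasurableState fun v => ρ.stateAt v i := by
    intro i
    induction i with
    | zero =>
      exact ⟨measurable_const, fun f => measurable_pi_apply f, fun f => measurable_const,
        fun p => MeasurableSet.const ((∅, ∅) = p)⟩
    | succ i ih =>
      simp only [stateAt_succ]
      exact ih.step ρ
  exact (this _).comp f

end RateRule

/-! ### Integrability of coflow completion times. -/

namespace CoflowInstance

variable {n : ℕ} {I O F Ω : Type*} [Fintype F] [DecidableEq F]

theorem le_coflowCompletion (X : CoflowInstance n I O F) (ρ : RateRule F) (v : F → ℝ) (f : F) :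
    ρ.flowCompletion v f ≤ X.coflowCompletion ρ v (X.coflow f) :=
  le_ciSup (f := fun g : {g // X.coflow g = X.coflow f} => ρ.flowCompletion v g)
    (Set.finite_range _).bddAbove ⟨f, rfl⟩

theorem coflowCompletion_nonneg (X : CoflowInstance n I O F) {ρ : RateRule F}
    (hρ : ∀ D G f, 0 ≤ ρ D G f) {v : F → ℝ} (hv : ∀ f, 0 ≤ v f) (k : Fin n) :
    0 ≤ X.coflowCompletion ρ v k :=
  Real.iSup_nonneg fun f => RateRule.flowCompletion_nonneg hρ hv f

/-- The dominating function is the total volume divided by a lower bound `c` on the positive rates.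
-/
theorem integrable_coflowCompletion [MeasurableSpace Ω] {P : Measure Ω}
    (X : CoflowInstance n I O F) {ρ : RateRule F} (hρ : ∀ D G f, 0 ≤ ρ D G f) {V : F → Ω → ℝ}
    (hV : ∀ f, 0 ≤ᵐ[P] V f) (hint : ∀ f, Integrable (V f) P) (k : Fin n) :
    Integrable (fun ω => X.coflowCompletion ρ (fun f => V f ω) k) P := by
  obtain ⟨c, hc, hcρ⟩ := ρ.exists_pos_le_rate
  have hmeas : Measurable fun v => X.coflowCompletion ρ v k :=
    Measurable.iSup fun f => ρ.measurable_flowCompletion f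
  refine Integrable.mono' (g := fun ω => (∑ f, V f ω) / c)
    ((integrable_finsetSum _ fun f _ => hint f).div_const c)
    (hmeas.comp_aemeasurable (aemeasurable_pi_lambda _ fun f =>
      (hint f).aemeasurable)).aestronglyMeasurable ?_
  filter_upwards [ae_all_iff.2 hV] with ω hω
  rw [Real.norm_of_nonneg (X.coflowCompletion_nonneg hρ hω k)]
  refine Real.iSup_le (fun f => ?_) (div_nonneg (Finset.sum_nonneg fun f _ => hω f) hc.le)
  rw [le_div_iff₀ hc, mul_comm]
  exact RateRule.mul_flowCompletion_le hρ hc hcρ hω f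

end CoflowInstance

/-! ### Upper bound for the greedy allocation. -/

namespace CoflowInstance

variable {n : ℕ} {I O F : Type*} [DecidableEq I] [DecidableEq O] [DecidableEq F]

omit [DecidableEq F] in
theorem mem_ports {X : CoflowInstance n I O F} {f : F} {ℓ : I ⊕ O} :
    ℓ ∈ X.ports f ↔ ℓ = Sum.inl (X.src f) ∨ ℓ = Sum.inr (X.dst f) := by
  simp [ports]

theorem greedyAlloc_nonneg (X : CoflowInstance n I O F) (l : List F) (c : I ⊕ O → ℝ)
    (hc : ∀ ℓ, 0 ≤ c ℓ) (g : F) : 0 ≤ X.greedyAlloc l c g := by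
  induction l generalizing c with
  | nil => simp [greedyAlloc]
  | cons f l ih =>
    simp only [greedyAlloc]
    split_ifs
    · exact le_min (hc _) (hc _)
    · refine ih _ fun ℓ => ?_
      split_ifs with h
      · rcases mem_ports.1 h with rfl | rfl <;> simp
      · exact hc ℓ

theorem greedyAlloc_of_notMem (X : CoflowInstance n I O F) {l : List F} (c : I ⊕ O → ℝ)
    {g : F} (hg : g ∉ l) : X.greedyAlloc l c g = 0 := by
  induction l generalizing c with
  | nil => simp [greedyAlloc]
  | cons f l ih =>
    rw [List.mem_cons, not_or] at hg
    simp [greedyAlloc, hg.1, ih _ hg.2]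

/-- Each listed flow has a port whose capacity is used up by flows of the same or higher
priority. -/
theorem exists_port_saturated [Fintype F] (X : CoflowInstance n I O F) {K : Type*} [LinearOrder K]
    (key : F → K) (l : List F) (hnd : l.Nodup) (hl : l.Pairwise fun f g => key f ≤ key g)
    (c : I ⊕ O → ℝ) (hc : ∀ ℓ, 0 ≤ c ℓ) {f : F} (hf : f ∈ l) :
    ∃ ℓ ∈ X.ports f,
      c ℓ ≤ ∑ g with key g ≤ key f ∧ ℓ ∈ X.ports g, X.greedyAlloc l c g := by
  induction l generalizing c with
  | nil => simp at hf
  | cons h l ih =>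
    rw [List.nodup_cons] at hnd
    rw [List.pairwise_cons] at hl
    set x := min (c (Sum.inl (X.src h))) (c (Sum.inr (X.dst h))) with hx
    set c' : I ⊕ O → ℝ := fun ℓ => if ℓ ∈ X.ports h then c ℓ - x else c ℓ with hc'
    have hc'0 : ∀ ℓ, 0 ≤ c' ℓ := fun ℓ => by
      simp only [hc']
      split_ifs with h1
      · rcases mem_ports.1 h1 with rfl | rfl <;> simp [hx]
      · exact hc ℓ
    -- As the list has no duplicates, the tail allocation gives nothing to `h`, and the two
    -- contributions simply add up.
    have hcons : ∀ g, X.greedyAlloc (h :: l) c g =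
        (if g = h then x else 0) + X.greedyAlloc l c' g := by
      intro g
      by_cases hg : g = h
      · subst hg; simp [greedyAlloc, X.greedyAlloc_of_notMem c' hnd.1, hx]
      · simp [greedyAlloc, hg, hc', hx]
    have hx0 : 0 ≤ x := le_min (hc _) (hc _)
    by_cases hfh : f = h
    · subst hfh
      have hself : ∀ ℓ ∈ X.ports f,
          x ≤ ∑ g with key g ≤ key f ∧ ℓ ∈ X.ports g, X.greedyAlloc (f :: l) c g := by
        intro ℓ hℓ
        have : X.greedyAlloc (f :: l) c f = x := by simp [greedyAlloc, hx]
        rw [← this]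
        exact Finset.single_le_sum (fun g _ => X.greedyAlloc_nonneg _ c hc g) (by simp [hℓ])
      -- The head of the list exhausts whichever of its ports attains the minimum.
      rcases min_choice (c (Sum.inl (X.src f))) (c (Sum.inr (X.dst f))) with h1 | h1
      · exact ⟨_, mem_ports.2 (Or.inl rfl), h1 ▸ hself _ (mem_ports.2 (Or.inl rfl))⟩
      · exact ⟨_, mem_ports.2 (Or.inr rfl), h1 ▸ hself _ (mem_ports.2 (Or.inr rfl))⟩
    · have hfl : f ∈ l := (List.mem_cons.1 hf).resolve_left hfh
      obtain ⟨ℓ, hℓ, hle⟩ := ih hnd.2 hl.2 c' hc'0 hfl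
      refine ⟨ℓ, hℓ, ?_⟩
      simp only [hcons, Finset.sum_add_distrib, Finset.sum_ite_eq', Finset.mem_filter,
        Finset.mem_univ, true_and]
      -- If `h` uses the port, the residual capacity is smaller by `x`, but `h` precedes `f` in the
      -- list and so contributes `x` to the sum.
      by_cases hℓh : ℓ ∈ X.ports h
      · simp only [hl.1 f hfl, hℓh, and_self, if_true]
        simp only [hc', hℓh, if_true] at hle
        linarith
      · simp only [hc', hℓh, if_false] at hle
        simpa [hℓh] using hle

theorem greedy_nonneg (X : CoflowInstance n I O F) (l : List F) (D G : Finset F) (f : F) :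
    0 ≤ X.greedy l D G f :=
  X.greedyAlloc_nonneg _ _ (fun ℓ => (X.cap_pos ℓ).le) f

theorem greedy_no_idling [Fintype F] (X : CoflowInstance n I O F) {l : List F} (hl : ∀ f, f ∈ l)
    (D G : Finset F) (hD : D ≠ Finset.univ) : ∃ f, f ∉ D ∧ 0 < X.greedy l D G f := by
  obtain ⟨g, hg⟩ : ∃ g, g ∉ D := by
    by_contra! h
    exact hD (Finset.eq_univ_iff_forall.2 h)
  have hgl : g ∈ l.filter fun f => f ∉ D := by simp [hl, hg]
  -- The first unfinished flow in the list meets untouched capacities, so its rate is positive.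
  rcases hcase : l.filter fun f => f ∉ D with _ | ⟨f, l'⟩
  · rw [hcase] at hgl; simp at hgl
  · have hf : f ∈ l.filter fun f => f ∉ D := by rw [hcase]; simp
    refine ⟨f, by simpa [hl] using hf, ?_⟩
    simp only [greedy, hcase, greedyAlloc, if_true]
    exact lt_min (X.cap_pos _) (X.cap_pos _)

/-- The load of port `ℓ` up to the priority `t`. -/
noncomputable def prefixLoad [Fintype F] (X : CoflowInstance n I O F)
    (π : Equiv.Perm (Fin n)) (v : F → ℝ)
    (ℓ : I ⊕ O) (t : Fin n) : ℝ :=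
  ∑ τ ∈ Finset.Iic t, X.procTime v ℓ (π τ)

omit [DecidableEq F] in
theorem prefixLoad_eq [Fintype F] (X : CoflowInstance n I O F) (π : Equiv.Perm (Fin n))
    (v : F → ℝ) (ℓ : I ⊕ O) (t : Fin n) :
    X.prefixLoad π v ℓ t =
      (∑ f with π.symm (X.coflow f) ≤ t ∧ ℓ ∈ X.ports f, v f) / X.cap ℓ := by
  simp only [prefixLoad, procTime]
  rw [← Finset.sum_div]
  congr 1
  rw [← Finset.sum_fiberwise_of_maps_to (s := Finset.univ.filter fun f =>
    π.symm (X.coflow f) ≤ t ∧ ℓ ∈ X.ports f) (t := Finset.Iic t)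
    (g := fun f => π.symm (X.coflow f)) (by simp +contextual)]
  refine Finset.sum_congr rfl fun τ hτ => Finset.sum_congr ?_ fun _ _ => rfl
  ext f
  simp only [Finset.mem_filter, Finset.mem_univ, true_and, Finset.mem_Iic] at hτ ⊢
  constructor
  · rintro ⟨h1, h2⟩
    simp [h1, h2, hτ]
  · rintro ⟨⟨-, h2⟩, h1⟩
    exact ⟨by simp [← h1], h2⟩

/-- Under the greedy allocation, a flow finishes no later than the sum of the loads that its two
ports have up to the priority of its coflow. -/
theorem flowCompletion_greedy_le [Fintype F] (X : CoflowInstance n I O F) {π : Equiv.Perm (Fin n)}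
    {l : List F} (hl : X.IsPriorityList π l) {v : F → ℝ} (hv : ∀ f, 0 ≤ v f) (f : F) :
    (X.greedy l).flowCompletion v f ≤
      X.prefixLoad π v (Sum.inl (X.src f)) (π.symm (X.coflow f)) +
      X.prefixLoad π v (Sum.inr (X.dst f)) (π.symm (X.coflow f)) := by
  obtain ⟨hnd, hmem, hpw⟩ := hl
  set key : F → Fin n := fun g => π.symm (X.coflow g) with hkey
  set ρ := X.greedy l with hρ
  have hρ0 : ∀ D G f, 0 ≤ ρ D G f := X.greedy_nonneg l
  have hidle := X.greedy_no_idling hmem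
  -- Work done on port `ℓ` for flows of the same or higher priority than `f`, in units of time. The
  -- invariant is that, while `f` is unfinished, the time is at most the sum of `W` over the two
  -- ports of `f`.
  let W : I ⊕ O → SimState F → ℝ := fun ℓ s =>
    (∑ g with key g ≤ key f ∧ ℓ ∈ X.ports g, (v g - s.rem g)) / X.cap ℓ
  have hWstep : ∀ i ℓ, W ℓ (ρ.stateAt v (i + 1)) = W ℓ (ρ.stateAt v i) +
      (∑ g with key g ≤ key f ∧ ℓ ∈ X.ports g,
        ρ (ρ.stateAt v i).done (ρ.stateAt v i).ongoing g) / X.cap ℓ *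
        ρ.delay (ρ.stateAt v i) := by
    intro i ℓ
    simp only [W]
    rw [div_mul_eq_mul_div, ← add_div, Finset.sum_mul, ← Finset.sum_add_distrib]
    congr 1
    refine Finset.sum_congr rfl fun g _ => ?_
    rw [RateRule.stateAt_succ, RateRule.rem_step ρ hρ0]
    split_ifs with hg
    -- Finished flows are filtered out of the greedy list, so they have rate `0`.
    · have : ρ (ρ.stateAt v i).done (ρ.stateAt v i).ongoing g = 0 :=
        X.greedyAlloc_of_notMem _ (by simp [hg])
      rw [this]; ring
    · ring
  -- `f` need only be unfinished at the beginning of the step, so this also covers the step in which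
  -- it finishes.
  have key_step : ∀ i, f ∉ (ρ.stateAt v i).done →
      (ρ.stateAt v i).time ≤ W (Sum.inl (X.src f)) (ρ.stateAt v i) +
        W (Sum.inr (X.dst f)) (ρ.stateAt v i) →
      (ρ.stateAt v (i + 1)).time ≤ W (Sum.inl (X.src f)) (ρ.stateAt v (i + 1)) +
        W (Sum.inr (X.dst f)) (ρ.stateAt v (i + 1)) := by
    intro i hf ih
    have hd := ρ.delay_nonneg _ (RateRule.regular_stateAt hρ0 hv i).rem_nonneg
    have htime : (ρ.stateAt v (i + 1)).time =
        (ρ.stateAt v i).time + ρ.delay (ρ.stateAt v i) := by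
      rw [RateRule.stateAt_succ]; rfl
    obtain ⟨ℓ, hℓ, hle⟩ := X.exists_port_saturated key
      (l.filter fun g => g ∉ (ρ.stateAt v i).done) (hnd.filter _) (hpw.filter _)
      X.cap (fun ℓ => (X.cap_pos ℓ).le) (f := f) (by simp [hmem, hf])
    have hinc : ∀ ℓ, 0 ≤ (∑ g with key g ≤ key f ∧ ℓ ∈ X.ports g,
        ρ (ρ.stateAt v i).done (ρ.stateAt v i).ongoing g) / X.cap ℓ *
        ρ.delay (ρ.stateAt v i) := fun ℓ =>
      mul_nonneg (div_nonneg (Finset.sum_nonneg fun g _ => hρ0 _ _ g) (X.cap_pos ℓ).le) hd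
    -- On the saturated port, `W` grows at least as fast as time; on the other port it does not
    -- decrease.
    have hsat : ρ.delay (ρ.stateAt v i) ≤ (∑ g with key g ≤ key f ∧ ℓ ∈ X.ports g,
        ρ (ρ.stateAt v i).done (ρ.stateAt v i).ongoing g) / X.cap ℓ *
        ρ.delay (ρ.stateAt v i) :=
      le_mul_of_one_le_left hd ((one_le_div (X.cap_pos ℓ)).2 hle)
    rw [htime, hWstep, hWstep]
    rcases mem_ports.1 hℓ with rfl | rfl
    · linarith [hinc (Sum.inr (X.dst f))]
    · linarith [hinc (Sum.inl (X.src f))]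
  have main : ∀ i, f ∉ (ρ.stateAt v i).done →
      (ρ.stateAt v i).time ≤ W (Sum.inl (X.src f)) (ρ.stateAt v i) +
        W (Sum.inr (X.dst f)) (ρ.stateAt v i) := by
    intro i
    induction i with
    | zero => intro _; simp [W, RateRule.stateAt_zero, RateRule.start]
    | succ i ih =>
      intro hf
      have hf' : f ∉ (ρ.stateAt v i).done := fun h => hf <| by
        rw [RateRule.stateAt_succ]; exact Finset.mem_union_left _ h
      exact key_step i hf' (ih hf')
  have hWle : ∀ i ℓ, W ℓ (ρ.stateAt v i) ≤ X.prefixLoad π v ℓ (key f) := by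
    intro i ℓ
    rw [prefixLoad_eq]
    refine div_le_div_of_nonneg_right (Finset.sum_le_sum fun g _ => ?_) (X.cap_pos ℓ).le
    linarith [(RateRule.regular_stateAt hρ0 hv i).rem_nonneg g]
  refine RateRule.flowCompletion_of_finishing hidle (fun t => t ≤ _) fun i hi => ?_
  have hf := (RateRule.mem_served.1 (RateRule.mem_finishing.1 hi).1).1
  exact (key_step i hf (main i hf)).trans (add_le_add (hWle _ _) (hWle _ _))

theorem coflowCompletion_greedy_le [Fintype F] [Fintype I] [Fintype O]
    (X : CoflowInstance n I O F) {π : Equiv.Perm (Fin n)}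
    {l : List F} (hl : X.IsPriorityList π l) {v : F → ℝ} (hv : ∀ f, 0 ≤ v f) (t : Fin n) :
    X.coflowCompletion (X.greedy l) v (π t) ≤ 2 * ⨆ ℓ, X.prefixLoad π v ℓ t := by
  have hle : ∀ ℓ, X.prefixLoad π v ℓ t ≤ ⨆ ℓ, X.prefixLoad π v ℓ t :=
    le_ciSup (Set.finite_range _).bddAbove
  have h0 : ∀ ℓ, 0 ≤ X.prefixLoad π v ℓ t := fun ℓ => by
    rw [prefixLoad_eq]
    exact div_nonneg (Finset.sum_nonneg fun g _ => hv g) (X.cap_pos ℓ).le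
  -- The bound must be nonnegative because a coflow without flows has completion time `0`, a
  -- supremum over an empty type.
  refine Real.iSup_le (fun f => ?_) (mul_nonneg zero_le_two (Real.iSup_nonneg h0))
  have := X.flowCompletion_greedy_le hl hv f
  rw [f.2, Equiv.symm_apply_apply] at this
  linarith [hle (Sum.inl (X.src f)), hle (Sum.inr (X.dst f))]

end CoflowInstance

/-! ### Parallel inequalities for order-based rules. -/

namespace CoflowInstance

variable {n : ℕ} {I O F Ω : Type*} [DecidableEq I] [DecidableEq O] [DecidableEq F] [Fintype F]

omit [DecidableEq F] [Fintype F] in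
theorem sharePort_of_mem_ports {X : CoflowInstance n I O F} {f g : F} {ℓ : I ⊕ O}
    (hf : ℓ ∈ X.ports f) (hg : ℓ ∈ X.ports g) : X.SharePort f g := by
  rcases mem_ports.1 hf with rfl | rfl <;> rcases mem_ports.1 hg with h | h <;>
    simp_all [SharePort]

open Classical in
/-- Under an order-based rule, a flow finishes on each of its ports after all flows that precede
it there. -/
theorem sum_le_cap_mul_flowCompletion (X : CoflowInstance n I O F) {ρ : RateRule F}
    (hρ : X.IsAdmissible ρ) {lt : F → F → Prop}
    (hlt : ∀ D G f, f ∉ D → (0 < ρ D G f ↔ ∀ g, g ∉ D → X.SharePort g f → ¬ lt g f))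
    {v : F → ℝ} (hv : ∀ f, 0 ≤ v f) {f : F} {ℓ : I ⊕ O} (hf : ℓ ∈ X.ports f) :
    ∑ g with ℓ ∈ X.ports g ∧ (g = f ∨ lt g f), v g ≤ X.cap ℓ * ρ.flowCompletion v f := by
  -- A port transmits at most its capacity per unit of time, whatever the rule.
  have htime : ∀ i, ∑ g with ℓ ∈ X.ports g, (v g - (ρ.stateAt v i).rem g) ≤
      X.cap ℓ * (ρ.stateAt v i).time := by
    intro i
    induction i with
    | zero => simp [RateRule.stateAt_zero, RateRule.start]
    | succ i ih =>
      have hd := ρ.delay_nonneg _ (RateRule.regular_stateAt hρ.nonneg hv i).rem_nonneg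
      rw [RateRule.stateAt_succ]
      set s := ρ.stateAt v i
      have ht : (ρ.step s).time = s.time + ρ.delay s := rfl
      have hsum : ∑ g with ℓ ∈ X.ports g, (v g - (ρ.step s).rem g) =
          ∑ g with ℓ ∈ X.ports g, (v g - s.rem g) +
          (∑ g with g ∉ s.done ∧ ℓ ∈ X.ports g, ρ s.done s.ongoing g) * ρ.delay s := by
        rw [Finset.sum_mul]
        simp only [Finset.sum_filter]
        rw [← Finset.sum_add_distrib]
        refine Finset.sum_congr rfl fun g _ => ?_
        rw [RateRule.rem_step ρ hρ.nonneg]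
        by_cases h1 : ℓ ∈ X.ports g <;> by_cases h2 : g ∈ s.done <;> simp [h1, h2]; ring
      rw [hsum, ht, mul_add]
      refine add_le_add ih (mul_le_mul_of_nonneg_right ?_ hd)
      exact hρ.capacity s.done s.ongoing ℓ
  refine RateRule.flowCompletion_of_finishing hρ.no_idling
    (fun t => _ ≤ X.cap ℓ * t) fun i hi => ?_
  have hr := RateRule.regular_stateAt hρ.nonneg hv (i + 1)
  have hfs := RateRule.mem_served.1 (RateRule.mem_finishing.1 hi).1
  have hdone : (ρ.stateAt v (i + 1)).done =
      (ρ.stateAt v i).done ∪ ρ.finishing (ρ.stateAt v i) := by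
    rw [RateRule.stateAt_succ]; rfl
  refine le_trans ?_ (htime (i + 1))
  calc ∑ g with ℓ ∈ X.ports g ∧ (g = f ∨ lt g f), v g
      = ∑ g with ℓ ∈ X.ports g ∧ (g = f ∨ lt g f), (v g - (ρ.stateAt v (i + 1)).rem g) := by
        refine Finset.sum_congr rfl fun g hg => ?_
        obtain ⟨hg1, hg2⟩ := (Finset.mem_filter.1 hg).2
        rw [hr.rem_done g, sub_zero]
        rw [hdone]
        rcases hg2 with rfl | hg2
        · exact Finset.mem_union_right _ hi
        · refine Finset.mem_union_left _ ?_
          -- `f` is served in this step, so no unfinished flow on a shared port precedes it.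
          by_contra h
          exact (hlt _ _ f hfs.1).1 hfs.2 g h (sharePort_of_mem_ports hg1 hf) hg2
    _ ≤ _ := by
        refine Finset.sum_le_sum_of_subset_of_nonneg (fun g hg => ?_) fun g _ _ => ?_
        · simp only [Finset.mem_filter, Finset.mem_univ, true_and] at hg ⊢
          exact hg.1
        · linarith [hr.rem_le g]

/-- In a sum of squares over a totally ordered set, each product occurs at most twice. -/
theorem sq_sum_le_two_mul_sum {ι : Type*} (B : Finset ι) (m : ι → ℝ) (hm : ∀ f, 0 ≤ m f)
    (lt : ι → ι → Prop) [∀ f, DecidablePred fun g => g = f ∨ lt g f]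
    (htot : ∀ f ∈ B, ∀ g ∈ B, f ≠ g → lt f g ∨ lt g f) :
    (∑ f ∈ B, m f) ^ 2 ≤ 2 * ∑ f ∈ B, m f * ∑ g ∈ B with g = f ∨ lt g f, m g := by
  have h1 : ∑ f ∈ B, m f * ∑ g ∈ B with g = f ∨ lt g f, m g =
      ∑ f ∈ B, ∑ g ∈ B, if g = f ∨ lt g f then m f * m g else 0 := by
    refine Finset.sum_congr rfl fun f _ => ?_
    rw [Finset.mul_sum, Finset.sum_filter]
  -- The same sum with the roles of `f` and `g` exchanged; added to `h1`, it counts every ordered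
  -- pair at least once, by totality.
  have h2 : ∑ f ∈ B, m f * ∑ g ∈ B with g = f ∨ lt g f, m g =
      ∑ f ∈ B, ∑ g ∈ B, if f = g ∨ lt f g then m f * m g else 0 := by
    rw [h1, Finset.sum_comm]
    simp only [mul_comm]
  rw [two_mul]
  nth_rewrite 1 [h1]
  rw [h2, sq, Finset.sum_mul_sum, ← Finset.sum_add_distrib]
  refine Finset.sum_le_sum fun f hf => ?_
  rw [← Finset.sum_add_distrib]
  refine Finset.sum_le_sum fun g hg => ?_
  have h0 := mul_nonneg (hm f) (hm g)
  by_cases hfg : f = g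
  · subst hfg; simp; linarith
  · rcases htot f hf g hg hfg with h | h <;> simp only [h, or_true, if_true] <;>
      (split_ifs; all_goals linarith)

variable [MeasurableSpace Ω] {P : Measure Ω}

omit [DecidableEq F] in
theorem meanProcTime_eq (X : CoflowInstance n I O F) {V : F → Ω → ℝ}
    (hint : ∀ f, Integrable (V f) P) (ℓ : I ⊕ O) (k : Fin n) :
    X.meanProcTime P V ℓ k =
      (∑ f with X.coflow f = k ∧ ℓ ∈ X.ports f, ∫ ω, V f ω ∂P) / X.cap ℓ := by
  simp only [meanProcTime, procTime]
  rw [integral_div, integral_finsetSum _ fun f _ => hint f]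

open Classical in
/-- The parallel inequalities for the expected completion times of an order-based rule. -/
theorem sq_sum_meanProcTime_le (X : CoflowInstance n I O F) {ρ : RateRule F}
    (hρ : X.IsAdmissible ρ) (hord : X.IsOrderBased ρ) {V : F → Ω → ℝ}
    (hV : ∀ f, 0 ≤ᵐ[P] V f) (hint : ∀ f, Integrable (V f) P) (A : Finset (Fin n)) (ℓ : I ⊕ O) :
    (∑ k ∈ A, X.meanProcTime P V ℓ k) ^ 2 ≤
      2 * ∑ k ∈ A, X.meanProcTime P V ℓ k *
        ∫ ω, X.coflowCompletion ρ (fun f => V f ω) k ∂P := by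
  obtain ⟨lt, -, htot, hlt⟩ := hord
  set E : Fin n → ℝ := fun k => ∫ ω, X.coflowCompletion ρ (fun f => V f ω) k ∂P with hE
  set m : F → ℝ := fun f => (∫ ω, V f ω ∂P) / X.cap ℓ with hm
  have hm0 : ∀ f, 0 ≤ m f := fun f =>
    div_nonneg (integral_nonneg_of_ae (hV f)) (X.cap_pos ℓ).le
  set B : Finset F := Finset.univ.filter fun f => X.coflow f ∈ A ∧ ℓ ∈ X.ports f with hB
  have hμ : ∀ k, X.meanProcTime P V ℓ k = ∑ f with X.coflow f = k ∧ ℓ ∈ X.ports f, m f := by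
    intro k
    rw [X.meanProcTime_eq hint, Finset.sum_div]
  have hfib : ∀ φ : F → ℝ, ∑ k ∈ A, ∑ f with X.coflow f = k ∧ ℓ ∈ X.ports f, φ f =
      ∑ f ∈ B, φ f := by
    intro φ
    rw [← Finset.sum_fiberwise_of_maps_to (s := B) (t := A) (g := X.coflow)
      (by simp +contextual [hB])]
    refine Finset.sum_congr rfl fun k hk => Finset.sum_congr ?_ fun _ _ => rfl
    ext f
    simp only [hB, Finset.mem_filter, Finset.mem_univ, true_and]
    constructor
    · rintro ⟨rfl, h⟩; exact ⟨⟨hk, h⟩, rfl⟩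
    · rintro ⟨⟨-, h⟩, rfl⟩; exact ⟨rfl, h⟩
  -- The index set on the left is fixed by `lt` and does not vary with `ω`, so the pathwise bound
  -- passes to expectations term by term.
  have hcomp : ∀ f, ℓ ∈ X.ports f →
      ∑ g with ℓ ∈ X.ports g ∧ (g = f ∨ lt g f), m g ≤ E (X.coflow f) := by
    intro f hf
    rw [hm, ← Finset.sum_div, ← integral_finsetSum _ fun g _ => hint g,
      div_le_iff₀ (X.cap_pos ℓ), mul_comm, ← integral_const_mul]
    refine integral_mono_ae (integrable_finsetSum _ fun g _ => hint g)
      ((X.integrable_coflowCompletion hρ.nonneg hV hint _).const_mul _) ?_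
    filter_upwards [ae_all_iff.2 hV] with ω hω
    exact (X.sum_le_cap_mul_flowCompletion hρ hlt hω hf).trans
      (mul_le_mul_of_nonneg_left (X.le_coflowCompletion ρ _ f) (X.cap_pos ℓ).le)
  calc (∑ k ∈ A, X.meanProcTime P V ℓ k) ^ 2 = (∑ f ∈ B, m f) ^ 2 := by
        simp only [hμ, hfib]
    _ ≤ 2 * ∑ f ∈ B, m f * ∑ g ∈ B with g = f ∨ lt g f, m g := by
        refine sq_sum_le_two_mul_sum B m hm0 lt fun f hf g hg hfg => htot f g hfg ?_
        simp only [hB, Finset.mem_filter] at hf hg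
        exact sharePort_of_mem_ports hf.2.2 hg.2.2
    _ ≤ 2 * ∑ f ∈ B, m f * E (X.coflow f) := by
        refine mul_le_mul_of_nonneg_left (Finset.sum_le_sum fun f hf => ?_) zero_le_two
        simp only [hB, Finset.mem_filter, Finset.mem_univ, true_and] at hf
        refine mul_le_mul_of_nonneg_left (le_trans ?_ (hcomp f hf.2)) (hm0 f)
        refine Finset.sum_le_sum_of_subset_of_nonneg (fun g hg => ?_) fun g _ _ => hm0 g
        simp only [hB, Finset.mem_filter, Finset.mem_univ, true_and] at hg ⊢
        exact ⟨hg.1.2, hg.2⟩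
    _ = 2 * ∑ k ∈ A, X.meanProcTime P V ℓ k * E k := by
        rw [← hfib]
        congr 1
        refine Finset.sum_congr rfl fun k _ => ?_
        rw [hμ, Finset.sum_mul]
        refine Finset.sum_congr rfl fun f hf => ?_
        rw [(Finset.mem_filter.1 hf).2.1]

open Classical in
/-- The order-based rule that serves the unblocked flows at the smaller capacity of their ports. -/
noncomputable def priorityRule (X : CoflowInstance n I O F) (lt : F → F → Prop) : RateRule F :=
  fun D _ f => if f ∉ D ∧ ∀ g, g ∉ D → X.SharePort g f → ¬ lt g f then
    min (X.cap (Sum.inl (X.src f))) (X.cap (Sum.inr (X.dst f))) else 0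

/-- Needed so that the infimum in `optimum` runs over a nonempty type: the real infimum of an empty
family is `0`, which would not be bounded below by the bottleneck sum. Any enumeration of the flows
provides a suitable order. -/
theorem exists_admissible_orderBased (X : CoflowInstance n I O F) :
    ∃ ρ : RateRule F, X.IsAdmissible ρ ∧ X.IsOrderBased ρ := by
  classical
  let e := Fintype.equivFin F
  let lt : F → F → Prop := fun f g => e f < e g
  have hpos : ∀ f, 0 < min (X.cap (Sum.inl (X.src f))) (X.cap (Sum.inr (X.dst f))) := fun f =>
    lt_min (X.cap_pos _) (X.cap_pos _)
  refine ⟨X.priorityRule lt, ⟨fun D G f => ?_, fun D G ℓ => ?_, fun D G hD => ?_⟩,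
    lt, ?_, fun f g hfg _ => ?_, fun D G f hf => ?_⟩
  · unfold priorityRule
    split_ifs
    · exact (hpos f).le
    · exact le_rfl
  · by_cases h : ∃ f, f ∉ D ∧ ℓ ∈ X.ports f ∧ ∀ g, g ∉ D → X.SharePort g f → ¬ lt g f
    · obtain ⟨f, hf, hℓ, hfmin⟩ := h
      have hval : X.priorityRule lt D G f ≤ X.cap ℓ := by
        simp only [priorityRule, hf, not_false_eq_true, true_and]
        rw [if_pos hfmin]
        rcases mem_ports.1 hℓ with rfl | rfl
        · exact min_le_left _ _
        · exact min_le_right _ _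
      refine le_trans (Finset.sum_eq_single f (fun g hg hgf => ?_) fun h => ?_).le hval
      · obtain ⟨hg1, hg2⟩ := (Finset.mem_filter.1 hg).2
        refine if_neg fun hg' => ?_
        rcases lt_trichotomy (e f) (e g) with h | h | h
        · exact hg'.2 f hf (sharePort_of_mem_ports hℓ hg2) h
        · exact hgf (e.injective h).symm
        · exact hfmin g hg1 (sharePort_of_mem_ports hg2 hℓ) h
      · exact absurd (Finset.mem_filter.2 ⟨Finset.mem_univ _, hf, hℓ⟩) h
    · push Not at h
      refine le_trans (Finset.sum_eq_zero fun g hg => if_neg fun hg' => ?_).le (X.cap_pos ℓ).le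
      obtain ⟨hg1, hg2⟩ := (Finset.mem_filter.1 hg).2
      obtain ⟨g', h1, h2, h3⟩ := h g hg1 hg2
      exact hg'.2 g' h1 h2 h3
  · have hne : (Finset.univ \ D).Nonempty := by
      rw [Finset.sdiff_nonempty]
      exact fun h => hD (Finset.univ_subset_iff.1 h)
    obtain ⟨f, hf, hmin⟩ := Finset.exists_min_image _ e hne
    have hfD : f ∉ D := by simpa using hf
    refine ⟨f, hfD, ?_⟩
    unfold priorityRule
    rw [if_pos ⟨hfD, fun g hg _ => not_lt.2 (hmin g (by simpa using hg))⟩]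
    exact hpos f
  · exact { irrefl := fun f => lt_irrefl (e f), trans := fun f g h => lt_trans }
  · exact lt_or_gt_of_ne fun h => hfg (e.injective h)
  · unfold priorityRule
    split_ifs with h
    · simp only [hpos, true_iff]; exact h.2
    · simp only [lt_irrefl, false_iff]; exact fun h' => h ⟨hf, h'⟩

end CoflowInstance

/-! ### Primal-dual analysis of Sincronia. -/

theorem SincroniaRun.mem_iff {n : ℕ} {L : Type*} {μ : L → Fin n → ℝ} {A : Finset (Fin n)}
    {w : Fin n → ℝ} {l : List (Fin n)} (h : SincroniaRun μ A w l) (j : Fin n) :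
    j ∈ l ↔ j ∈ A := by
  induction h with
  | nil => simp
  | step A w l b k hb hk hmin hrest ih =>
    rw [List.mem_append, List.mem_singleton, ih, Finset.mem_erase]
    by_cases h : j = k
    · simp [h, hk]
    · simp [h]

/-- Along a run of Sincronia, the prefix bottlenecks cost at most twice as much as any completion
times that satisfy the parallel inequalities. -/
theorem SincroniaRun.sum_le {n : ℕ} {L : Type*} [Finite L] {μ : L → Fin n → ℝ}
    (hμ : ∀ ℓ k, 0 ≤ μ ℓ k) {C : Fin n → ℝ} (hC0 : ∀ k, 0 ≤ C k)
    (hC : ∀ (A : Finset (Fin n)) ℓ, (∑ k ∈ A, μ ℓ k) ^ 2 ≤ 2 * ∑ k ∈ A, μ ℓ k * C k)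
    {M : Fin n → ℝ} {A : Finset (Fin n)} {w : Fin n → ℝ} {l : List (Fin n)}
    (h : SincroniaRun μ A w l) (hw : ∀ k ∈ A, 0 ≤ w k)
    (hM : ∀ p k q, l = p ++ k :: q → M k ≤ ⨆ ℓ, ∑ j ∈ (p ++ [k]).toFinset, μ ℓ j) :
    ∑ k ∈ A, w k * M k ≤ 2 * ∑ k ∈ A, w k * C k := by
  induction h with
  | nil => simp
  | step A w l b k hb hk hmin hrest ih =>
    -- A prefix ending in `j` is contained in `A`, and `b` is the bottleneck of `A`.
    have hMle : ∀ j ∈ A, M j ≤ ∑ i ∈ A, μ b i := by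
      intro j hj
      have hmem : ∀ i, i ∈ l ++ [k] ↔ i ∈ A :=
        (SincroniaRun.step A w l b k hb hk hmin hrest).mem_iff
      obtain ⟨p, q, hpq⟩ := List.append_of_mem ((hmem j).2 hj)
      refine (hM p j q hpq).trans ?_
      have : Nonempty L := ⟨b⟩
      refine ciSup_le fun ℓ => le_trans ?_ (hb ℓ)
      refine Finset.sum_le_sum_of_subset_of_nonneg (fun i hi => ?_) fun i _ _ => hμ ℓ i
      rw [← hmem, hpq]
      simp only [List.mem_toFinset, List.mem_append, List.mem_cons] at hi ⊢
      tauto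
    by_cases h0 : μ b k = 0
    · have hzero : ∀ j ∈ A, μ b j = 0 := by
        intro j hj
        by_contra hne
        have := hmin j hj
        simp [weightRatio, h0, hne] at this
      have hM0 : ∀ j ∈ A, M j ≤ 0 := fun j hj =>
        (hMle j hj).trans (Finset.sum_eq_zero hzero).le
      calc ∑ k ∈ A, w k * M k ≤ 0 :=
            Finset.sum_nonpos fun j hj => mul_nonpos_of_nonneg_of_nonpos (hw j hj) (hM0 j hj)
        _ ≤ _ := mul_nonneg zero_le_two
            (Finset.sum_nonneg fun j hj => mul_nonneg (hw j hj) (hC0 j))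
    · have hpos : 0 < μ b k := lt_of_le_of_ne (hμ b k) (Ne.symm h0)
      -- The dual variable of the parallel inequality for `A` and `b`. Minimality of the ratio keeps
      -- the reduced weights nonnegative, and that of `k` becomes `0`.
      set y := w k / μ b k with hy
      have hy0 : 0 ≤ y := div_nonneg (hw k hk) hpos.le
      set w' : Fin n → ℝ := fun j => if j ∈ A then w j - w k * μ b j / μ b k else w j with hw'
      have hw'A : ∀ j ∈ A, w' j = w j - y * μ b j := by
        intro j hj
        simp only [hw', hj, if_true, hy]
        ring
      have hw'0 : ∀ j ∈ A, 0 ≤ w' j := by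
        intro j hj
        rw [hw'A j hj]
        rcases (hμ b j).eq_or_lt with hj0 | hj0
        · rw [← hj0]; simpa using hw j hj
        · have := hmin j hj
          simp only [weightRatio, h0, hj0.ne', if_false, WithTop.coe_le_coe] at this
          rw [← hy, le_div_iff₀ hj0] at this
          linarith
      have hw'k : w' k = 0 := by
        rw [hw'A k hk, hy]; field_simp; ring
      -- The induction hypothesis handles the first sum, the parallel inequality `hC A b` the
      -- second.
      have hsplit : ∀ φ : Fin n → ℝ, ∑ j ∈ A, w j * φ j =
          ∑ j ∈ A.erase k, w' j * φ j + y * ∑ j ∈ A, μ b j * φ j := by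
        intro φ
        rw [Finset.sum_erase _ (by rw [hw'k, zero_mul]), Finset.mul_sum,
          ← Finset.sum_add_distrib]
        refine Finset.sum_congr rfl fun j hj => ?_
        rw [hw'A j hj]; ring
      -- A prefix of `l` is also a prefix of `l ++ [k]`, so the bottleneck hypothesis carries over.
      have ih' := ih (fun j hj => hw'0 j (Finset.mem_of_mem_erase hj)) fun p j q hpq =>
        hM p j (q ++ [k]) (by simp [hpq])
      have hsq : ∑ j ∈ A, μ b j * M j ≤ (∑ j ∈ A, μ b j) ^ 2 := by
        rw [sq, Finset.sum_mul]
        exact Finset.sum_le_sum fun j hj => mul_le_mul_of_nonneg_left (hMle j hj) (hμ b j)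
      have := mul_le_mul_of_nonneg_left (hsq.trans (hC A b)) hy0
      rw [hsplit, hsplit]
      linarith

/-! ### Expected bottlenecks, the ratio `alpha`, and the conclusion. -/

namespace CoflowInstance

variable {n : ℕ} {I O F Ω : Type*} [DecidableEq I] [DecidableEq O] [Fintype F]
  [MeasurableSpace Ω] {P : Measure Ω}

theorem meanProcTime_nonneg (X : CoflowInstance n I O F) {V : F → Ω → ℝ}
    (hV : ∀ f, 0 ≤ᵐ[P] V f) (ℓ : I ⊕ O) (k : Fin n) : 0 ≤ X.meanProcTime P V ℓ k := by
  refine integral_nonneg_of_ae ?_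
  filter_upwards [ae_all_iff.2 hV] with ω hω
  exact div_nonneg (Finset.sum_nonneg fun f _ => hω f) (X.cap_pos ℓ).le

theorem integrable_procTime (X : CoflowInstance n I O F) {V : F → Ω → ℝ}
    (hint : ∀ f, Integrable (V f) P) (ℓ : I ⊕ O) (k : Fin n) :
    Integrable (fun ω => X.procTime (fun f => V f ω) ℓ k) P :=
  (integrable_finsetSum _ fun f _ => hint f).div_const _

theorem integrable_prefixLoad (X : CoflowInstance n I O F) (π : Equiv.Perm (Fin n))
    {V : F → Ω → ℝ} (hint : ∀ f, Integrable (V f) P) (ℓ : I ⊕ O) (t : Fin n) :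
    Integrable (fun ω => X.prefixLoad π (fun f => V f ω) ℓ t) P :=
  integrable_finsetSum _ fun _ _ => X.integrable_procTime hint ℓ _

theorem prefixLoad_nonneg (X : CoflowInstance n I O F) (π : Equiv.Perm (Fin n)) {v : F → ℝ}
    (hv : ∀ f, 0 ≤ v f) (ℓ : I ⊕ O) (t : Fin n) : 0 ≤ X.prefixLoad π v ℓ t :=
  Finset.sum_nonneg fun _ _ => div_nonneg (Finset.sum_nonneg fun f _ => hv f) (X.cap_pos ℓ).le

variable [Fintype I] [Fintype O]

/-- Serves both as an integrable bound and to show that the expected bottleneck vanishes when all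
expected loads do. -/
theorem iSup_prefixLoad_le_sum (X : CoflowInstance n I O F) (π : Equiv.Perm (Fin n)) {v : F → ℝ}
    (hv : ∀ f, 0 ≤ v f) (t : Fin n) :
    ⨆ ℓ, X.prefixLoad π v ℓ t ≤ ∑ ℓ, X.prefixLoad π v ℓ t :=
  Real.iSup_le (fun ℓ => Finset.single_le_sum (f := fun ℓ => X.prefixLoad π v ℓ t)
    (fun ℓ _ => X.prefixLoad_nonneg π hv ℓ t) (Finset.mem_univ ℓ))
    (Finset.sum_nonneg fun ℓ _ => X.prefixLoad_nonneg π hv ℓ t)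

theorem integrable_iSup_prefixLoad (X : CoflowInstance n I O F) (π : Equiv.Perm (Fin n))
    {V : F → Ω → ℝ} (hV : ∀ f, 0 ≤ᵐ[P] V f) (hint : ∀ f, Integrable (V f) P) (t : Fin n) :
    Integrable (fun ω => ⨆ ℓ, X.prefixLoad π (fun f => V f ω) ℓ t) P := by
  refine Integrable.mono' (integrable_finsetSum Finset.univ fun ℓ _ =>
    X.integrable_prefixLoad π hint ℓ t)
    (AEMeasurable.iSup fun ℓ =>
      (X.integrable_prefixLoad π hint ℓ t).aemeasurable).aestronglyMeasurable ?_
  filter_upwards [ae_all_iff.2 hV] with ω hω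
  rw [Real.norm_of_nonneg (Real.iSup_nonneg fun ℓ => X.prefixLoad_nonneg π hω ℓ t)]
  exact X.iSup_prefixLoad_le_sum π hω t

/-- The expected bottleneck load of a prefix is at most `α` times the bottleneck of its expected
loads. -/
theorem integral_iSup_prefixLoad_le (X : CoflowInstance n I O F) (π : Equiv.Perm (Fin n))
    {V : F → Ω → ℝ} (hV : ∀ f, 0 ≤ᵐ[P] V f) (hint : ∀ f, Integrable (V f) P) (t : Fin n) :
    ∫ ω, ⨆ ℓ, X.prefixLoad π (fun f => V f ω) ℓ t ∂P ≤
      X.alpha P V π * ⨆ ℓ, ∑ τ ∈ Finset.Iic t, X.meanProcTime P V ℓ (π τ) := by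
  have hmean : ∀ ℓ, ∑ τ ∈ Finset.Iic t, X.meanProcTime P V ℓ (π τ) =
      ∫ ω, X.prefixLoad π (fun f => V f ω) ℓ t ∂P := fun ℓ =>
    (integral_finsetSum _ fun τ _ => X.integrable_procTime hint ℓ (π τ)).symm
  have hM0 : 0 ≤ ⨆ ℓ, ∑ τ ∈ Finset.Iic t, X.meanProcTime P V ℓ (π τ) :=
    Real.iSup_nonneg fun ℓ => Finset.sum_nonneg fun τ _ => X.meanProcTime_nonneg hV ℓ _
  -- With a zero denominator `alpha` gives no information; but then every port has expected load
  -- `0`, and so does the sum over the ports, which dominates the maximum.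
  rcases hM0.eq_or_lt with h0 | hpos
  · rw [← h0, mul_zero]
    calc ∫ ω, ⨆ ℓ, X.prefixLoad π (fun f => V f ω) ℓ t ∂P
        ≤ ∫ ω, ∑ ℓ, X.prefixLoad π (fun f => V f ω) ℓ t ∂P := by
          refine integral_mono_ae (X.integrable_iSup_prefixLoad π hV hint t)
            (integrable_finsetSum _ fun ℓ _ => X.integrable_prefixLoad π hint ℓ t) ?_
          filter_upwards [ae_all_iff.2 hV] with ω hω
          exact X.iSup_prefixLoad_le_sum π hω t
      _ = ∑ ℓ, ∑ τ ∈ Finset.Iic t, X.meanProcTime P V ℓ (π τ) := by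
          rw [integral_finsetSum _ fun ℓ _ => X.integrable_prefixLoad π hint ℓ t]
          simp only [hmean]
      _ ≤ 0 := Finset.sum_nonpos fun ℓ _ => h0 ▸
          le_ciSup (f := fun ℓ => ∑ τ ∈ Finset.Iic t, X.meanProcTime P V ℓ (π τ))
            (Set.finite_range _).bddAbove ℓ
  · rw [← div_le_iff₀ hpos]
    exact le_ciSup (f := fun t : Fin n =>
      (∫ ω, ⨆ ℓ, ∑ τ ∈ Finset.Iic t, X.procTime (fun f => V f ω) ℓ (π τ) ∂P) /
        (⨆ ℓ, ∑ τ ∈ Finset.Iic t, X.meanProcTime P V ℓ (π τ)))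
      (Set.finite_range _).bddAbove t

omit [Fintype I] [Fintype O] in
theorem alpha_nonneg (X : CoflowInstance n I O F) (π : Equiv.Perm (Fin n)) {V : F → Ω → ℝ}
    (hV : ∀ f, 0 ≤ᵐ[P] V f) : 0 ≤ X.alpha P V π := by
  refine Real.iSup_nonneg fun t => div_nonneg (integral_nonneg_of_ae ?_)
    (Real.iSup_nonneg fun ℓ => Finset.sum_nonneg fun τ _ => X.meanProcTime_nonneg hV ℓ _)
  filter_upwards [ae_all_iff.2 hV] with ω hω
  exact Real.iSup_nonneg fun ℓ => X.prefixLoad_nonneg π hω ℓ t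

variable [DecidableEq F]

theorem expectedCost_greedy_le (X : CoflowInstance n I O F) {π : Equiv.Perm (Fin n)}
    {l : List F} (hl : X.IsPriorityList π l) {V : F → Ω → ℝ} (hV : ∀ f, 0 ≤ᵐ[P] V f)
    (hint : ∀ f, Integrable (V f) P) :
    X.expectedCost P V (X.greedy l) ≤ 2 * X.alpha P V π *
      ∑ k, X.weight k * ⨆ ℓ, ∑ τ ∈ Finset.Iic (π.symm k), X.meanProcTime P V ℓ (π τ) := by
  rw [expectedCost, Finset.mul_sum]
  refine Finset.sum_le_sum fun k _ => ?_
  have h1 : ∫ ω, X.coflowCompletion (X.greedy l) (fun f => V f ω) k ∂P ≤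
      ∫ ω, 2 * ⨆ ℓ, X.prefixLoad π (fun f => V f ω) ℓ (π.symm k) ∂P := by
    refine integral_mono_ae (X.integrable_coflowCompletion (X.greedy_nonneg l) hV hint k)
      ((X.integrable_iSup_prefixLoad π hV hint _).const_mul _) ?_
    filter_upwards [ae_all_iff.2 hV] with ω hω
    simpa using X.coflowCompletion_greedy_le hl hω (π.symm k)
  rw [integral_const_mul] at h1
  have h2 := X.integral_iSup_prefixLoad_le π hV hint (π.symm k)
  calc _ ≤ X.weight k * (2 * (X.alpha P V π * _)) :=
        mul_le_mul_of_nonneg_left (h1.trans (mul_le_mul_of_nonneg_left h2 zero_le_two))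
          (X.weight_nonneg k)
    _ = _ := by ring

/-- Every order-based rule costs at least half as much as the prefix bottlenecks of a Sincronia
order. -/
theorem sum_weight_mul_bottleneck_le (X : CoflowInstance n I O F) {π : Equiv.Perm (Fin n)}
    {V : F → Ω → ℝ} (hV : ∀ f, 0 ≤ᵐ[P] V f) (hint : ∀ f, Integrable (V f) P)
    (hπ : SincroniaRun (X.meanProcTime P V) Finset.univ X.weight (List.ofFn π))
    {ρ : RateRule F} (hρ : X.IsAdmissible ρ) (hord : X.IsOrderBased ρ) :
    ∑ k, X.weight k * ⨆ ℓ, ∑ τ ∈ Finset.Iic (π.symm k), X.meanProcTime P V ℓ (π τ) ≤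
      2 * X.expectedCost P V ρ := by
  refine hπ.sum_le (X.meanProcTime_nonneg hV) (fun k => integral_nonneg_of_ae ?_)
    (X.sq_sum_meanProcTime_le hρ hord hV hint) (fun k _ => X.weight_nonneg k)
    fun p k q hpq => le_of_eq ?_
  · filter_upwards [ae_all_iff.2 hV] with ω hω
    exact X.coflowCompletion_nonneg hρ.nonneg hω k
  · have hlen : n = p.length + (q.length + 1) := by
      have := congrArg List.length hpq
      simpa using this
    have hget : ∀ (i : ℕ) (hi : i < n), (p ++ k :: q)[i]? = some (π ⟨i, hi⟩) := by
      intro i hi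
      rw [← hpq]
      simp [hi]
    have hk : k = π ⟨p.length, by omega⟩ := by
      have := hget p.length (by omega)
      simpa using this
    -- The entry `k` stands at position `p.length` of the order, so the list up to and including `k`
    -- is the image of `Iic (π.symm k)` under `π`.
    have hset : (p ++ [k]).toFinset = (Finset.Iic (π.symm k)).map π.toEmbedding := by
      ext j
      obtain ⟨i, rfl⟩ := π.surjective j
      have hki : π.symm k = ⟨p.length, by omega⟩ := by rw [hk, Equiv.symm_apply_apply]
      have hpre : p ++ [k] = (List.ofFn π).take (p.length + 1) := by
        rw [hpq]; simp [List.take_append]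
      rw [hpre, hki]
      simp only [List.mem_toFinset, List.mem_take_iff_getElem, Finset.mem_map_equiv,
        Equiv.symm_apply_apply, Finset.mem_Iic, List.getElem_ofFn, List.length_ofFn,
        EmbeddingLike.apply_eq_iff_eq, Fin.le_def]
      constructor
      · rintro ⟨a, ha, rfl⟩
        simp only at *
        omega
      · intro h
        exact ⟨i, by omega, rfl⟩
    simp only [hset, Finset.sum_map, Equiv.coe_toEmbedding]

end CoflowInstance

theorem theorem3 {n : ℕ} {I O F Ω : Type*} [Fintype I] [Fintype O] [Fintype F]
    [DecidableEq I] [DecidableEq O] [DecidableEq F] [MeasurableSpace Ω]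
    (P : Measure Ω) [IsProbabilityMeasure P]
    (X : CoflowInstance n I O F) (V : F → Ω → ℝ)
    (hV_nonneg : ∀ f, 0 ≤ᵐ[P] V f)
    (hV_indep : iIndepFun V P)
    (hV_moment : ∀ f, MemLp (V f) 2 P)
    (π : Equiv.Perm (Fin n))
    (hπ : SincroniaRun (X.meanProcTime P V) Finset.univ X.weight (List.ofFn π))
    (l : List F) (hl : X.IsPriorityList π l) :
    (∀ k, Integrable (fun ω => X.coflowCompletion (X.greedy l) (fun f => V f ω) k) P) ∧
    (∀ ρ : RateRule F, X.IsAdmissible ρ → X.IsOrderBased ρ →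
      ∀ k, Integrable (fun ω => X.coflowCompletion ρ (fun f => V f ω) k) P) ∧
    X.expectedCost P V (X.greedy l) ≤ 4 * X.alpha P V π * X.optimum P V := by
  have hint : ∀ f, Integrable (V f) P := fun f => (hV_moment f).integrable one_le_two
  refine ⟨X.integrable_coflowCompletion (X.greedy_nonneg l) hV_nonneg hint,
    fun ρ hρ _ => X.integrable_coflowCompletion hρ.nonneg hV_nonneg hint, ?_⟩
  obtain ⟨ρ₀, hρ₀⟩ := X.exists_admissible_orderBased
  have : Nonempty {ρ : RateRule F // X.IsAdmissible ρ ∧ X.IsOrderBased ρ} := ⟨⟨ρ₀, hρ₀⟩⟩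
  have hopt : (∑ k, X.weight k *
      ⨆ ℓ, ∑ τ ∈ Finset.Iic (π.symm k), X.meanProcTime P V ℓ (π τ)) / 2 ≤
      X.optimum P V := by
    refine le_ciInf fun ρ => ?_
    rw [div_le_iff₀' zero_lt_two]
    exact X.sum_weight_mul_bottleneck_le hV_nonneg hint hπ ρ.2.1 ρ.2.2
  have hα := X.alpha_nonneg π hV_nonneg
  have hcost := X.expectedCost_greedy_le hl hV_nonneg hint
  -- With `S` the weighted bottleneck sum, greedy costs at most `2 α S`, and `S / 2` is at most the
  -- optimum.
  nlinarith [mul_le_mul_of_nonneg_left hopt hα]
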